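/- Let $\mathfrak c = 2^{\aleph_0}$ and let the dominating number $\mathfrak d$ be the least cardinality of a family $D\subseteq\omega^\omega$ such that for every $f\in\omega^\omega$ there is $g\in D$ with $f(n)\le g(n)$ for all but finitely many $n$. An almost disjoint family (on $\omega$) is an infinite set $\mathcal A$ of infinite subsets of $\omega$ such that $A\cap B$ is finite for any two distinct $A,B\in\mathcal A$; a mad family is an almost disjoint family that is maximal with respect to inclusion among almost disjoint families. The ideal generated by $\mathcal A$ is $$\mathcal I(\mathcal A)=\Big\{I\subseteq\omega : \text{there is a finite } \mathcal B\subseteq\mathcal A \text{ such that } I\setminus\bigcup\mathcal B \text{ is finite}\Big\}.$$ The power set $\mathcal P(\omega)$ carries the topology of the Cantor space $2^\omega$, subsets of $\omega$ being identified with their characteristic functions, and families of subsets of $\omega$ carry the subspace topology. A topological space $X$ is Menger if for every sequence $\langle \mathcal U_n : n\in\omega\rangle$ of open covers of $X$ there are finite $\mathcal V_n\subseteq\mathcal U_n$ such that $\{\bigcup\mathcal V_n : n\in\omega\}$ covers $X$. **Proposition 3.2.** If $\mathfrak d=\mathfrak c$, then there is an infinite mad family $\mathcal A$ on $\omega$ such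 that $\mathcal I(\mathcal A)$, as a subspace of $\mathcal P(\omega)$, is Menger. -/

import Mathlib

/-- A topological space is Menger if for every sequence of open covers `U n` one can choose finite
subfamilies `V n ⊆ U n` whose unions `⋃₀ V n` together cover the space. -/
def MengerSpace (X : Type*) [TopologicalSpace X] : Prop :=
  ∀ U : ℕ → Set (Set X),
    (∀ n, (∀ u ∈ U n, IsOpen u) ∧ ⋃₀ U n = Set.univ) →
    ∃ V : ℕ → Set (Set X),
      (∀ n, V n ⊆ U n ∧ (V n).Finite) ∧ ⋃ n, ⋃₀ V n = Set.univ

/-- A family `S` of subsets of `ℕ`, viewed as a subset of the Cantor space `ℕ → Bool`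
(with the product topology) by identifying sets with their characteristic functions. -/
def charFunctionSet (S : Set (Set ℕ)) : Set (ℕ → Bool) :=
  {x | {n | x n = true} ∈ S}

/-- `S` is Menger as a subspace of the power set of `ℕ`. -/
def IsMengerFamily (S : Set (Set ℕ)) : Prop :=
  MengerSpace (charFunctionSet S)

/-- An almost disjoint family on `ℕ`: an infinite family of infinite subsets of `ℕ`, any two
distinct members of which have finite intersection. -/
def IsAlmostDisjointFamily (A : Set (Set ℕ)) : Prop :=
  A.Infinite ∧ (∀ a ∈ A, a.Infinite) ∧ A.Pairwise fun a b => (a ∩ b).Finite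

/-- A mad family on `ℕ`: an almost disjoint family that is maximal under inclusion. -/
def IsMadFamily (A : Set (Set ℕ)) : Prop :=
  Maximal IsAlmostDisjointFamily A

/-- The ideal generated by `A`: the subsets of `ℕ` that are covered, up to finitely many points, by
the union of finitely many members of `A`. -/
def generatedIdeal (A : Set (Set ℕ)) : Set (Set ℕ) :=
  {I | ∃ B ⊆ A, B.Finite ∧ (I \ ⋃₀ B).Finite}

/-- A family of functions `ℕ → ℕ` is dominating if every function is bounded by some member of
the family at all but finitely many arguments. -/
def IsDominating (D : Set (ℕ → ℕ)) : Prop :=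
  ∀ f : ℕ → ℕ, ∃ g ∈ D, ∀ᶠ n in Filter.atTop, f n ≤ g n

/-- The dominating number: the least cardinality of a dominating family. -/
noncomputable def dominatingNumber : Cardinal.{0} :=
  sInf {κ | ∃ D : Set (ℕ → ℕ), IsDominating D ∧ Cardinal.mk D = κ}

/-!
Call a set `Z` of finite sets positive for an ideal `I` if every member of `I` is disjoint from
some `s ∈ Z`. By compactness of the power sets `𝒫(J)`, `J ∈ I`, the Menger property of `I` reduces
to the following: for every sequence `X n` of positive sets there is `g : ℕ → ℕ` such that
`⋃ n, {s ∈ X n | s ⊆ [0, g n)}` is positive as well.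

As `𝔡 = 𝔠`, a mad family with this property is built in `𝔠` steps, while keeping a list of fewer
than `𝔠` sets that must stay positive for the ideal. An ideal with fewer than `𝔡` generators has
such a `g` for every `X`, and the resulting set is put on the list. An infinite set `b` that is
almost disjoint from the family constructed so far contains an infinite `a` so sparse that all sets
on the list stay positive after `a` is added to the family: `a` has to miss, for each of fewer than
`𝔡` functions `h`, an interval `[m, h m]`.
-/

open Cardinal Filter Order

section FiniteCharacter

universe u

variable {α ι : Type*} {F : Set (Set α)} {S₀ : Set α}

theorem union_image_mem_of_forall_Iic [LinearOrder ι] (hF : IsOfFiniteCharacter F) (hS₀ : S₀ ∈ F)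
    {x : ι → α} {T : Set ι} (h : ∀ t ∈ T, S₀ ∪ x '' Set.Iic t ∈ F) : S₀ ∪ x '' T ∈ F := by
  refine (hF _).2 fun Y hY hYfin => ?_
  obtain ⟨T', hT'T, hT', hYT'⟩ : ∃ T' ⊆ T, T'.Finite ∧ Y \ S₀ = x '' T' := by
    simpa [eq_comm] using Set.exists_subset_image_finite_and.1
      ⟨Y \ S₀, Set.sdiff_subset_iff.2 hY, hYfin.sdiff, rfl⟩
  have hY' : Y ⊆ S₀ ∪ x '' T' := Set.sdiff_subset_iff.1 hYT'.le
  rcases T'.eq_empty_or_nonempty with rfl | hne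
  · exact (hF S₀).1 hS₀ Y (by simpa using hY') hYfin
  · obtain ⟨t, ht, hmax⟩ := Set.exists_max_image T' id hT' hne
    exact (hF _).1 (h t (hT'T ht)) Y
      (hY'.trans (Set.union_subset_union_right _ (Set.image_mono hmax))) hYfin

theorem exists_forall_eq_apply_image_Iio [LinearOrder ι] [WellFoundedLT ι]
    (next : ι → Set α → α) : ∃ x : ι → α, ∀ t, x t = next t (x '' Set.Iio t) := by
  let step : ∀ t : ι, (∀ u, u < t → α) → α := fun t x =>
    next t (Set.range fun u : Set.Iio t => x u u.2)
  refine ⟨(wellFounded_lt (α := ι)).fix step, fun t => ?_⟩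
  rw [WellFounded.fix_eq, Set.image_eq_range]

variable {α ι : Type u} {F : Set (Set α)} {S₀ : Set α}

theorem exists_superset_forall_mem_of_wellFoundedLT [LinearOrder ι] [WellFoundedLT ι]
    {κ : Cardinal.{u}} (hκ : ℵ₀ ≤ κ) (hι : ∀ t : ι, #(Set.Iio t) < κ)
    (hF : IsOfFiniteCharacter F) {D : ι → Set (Set α)} (hD : ∀ t, IsUpperSet (D t))
    (hS₀F : S₀ ∈ F) (hS₀ : S₀.Nonempty) (hS₀κ : #S₀ < κ)
    (hstep : ∀ t, ∀ S ∈ F, #S < κ → S ∉ D t → ∃ x, insert x S ∈ F ∧ insert x S ∈ D t) :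
    ∃ S ∈ F, S₀ ⊆ S ∧ ∀ t, S ∈ D t := by
  obtain ⟨x₀, hx₀⟩ := hS₀
  have : Nonempty α := ⟨x₀⟩
  have hnext : ∀ t X, S₀ ∪ X ∈ F → #(S₀ ∪ X : Set α) < κ →
      ∃ x, insert x (S₀ ∪ X) ∈ F ∧ insert x (S₀ ∪ X) ∈ D t := by
    intro t X hXF hXκ
    by_cases hX : S₀ ∪ X ∈ D t
    · have hinsert : insert x₀ (S₀ ∪ X) = S₀ ∪ X :=
        Set.insert_eq_of_mem (Set.mem_union_left X hx₀)
      exact ⟨x₀, hinsert.symm ▸ hXF, hinsert.symm ▸ hX⟩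
    · exact hstep t _ hXF hXκ hX
  choose! next hnext using hnext
  obtain ⟨x, hx⟩ := exists_forall_eq_apply_image_Iio next
  have hinsert : ∀ t, insert (x t) (S₀ ∪ x '' Set.Iio t) = S₀ ∪ x '' Set.Iic t := fun t => by
    rw [← Set.Iio_insert, Set.image_insert_eq, Set.union_insert]
  have hcard : ∀ t, #(S₀ ∪ x '' Set.Iio t : Set α) < κ := fun t =>
    (mk_union_le _ _).trans_lt (add_lt_of_lt hκ hS₀κ (mk_image_le.trans_lt (hι t)))
  have hspec : ∀ t, S₀ ∪ x '' Set.Iic t ∈ F ∧ S₀ ∪ x '' Set.Iic t ∈ D t := by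
    intro t
    induction t using WellFoundedLT.induction with
    | ind t ih =>
      rw [← hinsert, hx t]
      exact hnext t _ (union_image_mem_of_forall_Iic hF hS₀F fun u hu => (ih u hu).1) (hcard t)
  refine ⟨S₀ ∪ x '' Set.univ, union_image_mem_of_forall_Iic hF hS₀F fun t _ => (hspec t).1,
    Set.subset_union_left, fun t => hD t ?_ (hspec t).2⟩
  exact Set.union_subset_union_right _ (Set.image_mono (Set.subset_univ _))

/-- A Rasiowa–Sikorski lemma for `κ` requirements: finite character takes care of limit stages. -/
theorem exists_superset_forall_mem {κ : Cardinal.{u}} (hκ : ℵ₀ ≤ κ) (hι : #ι ≤ κ)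
    (hF : IsOfFiniteCharacter F) {D : ι → Set (Set α)} (hD : ∀ i, IsUpperSet (D i))
    (hS₀F : S₀ ∈ F) (hS₀ : S₀.Nonempty) (hS₀κ : #S₀ < κ)
    (hstep : ∀ i, ∀ S ∈ F, #S < κ → S ∉ D i → ∃ x, insert x S ∈ F ∧ insert x S ∈ D i) :
    ∃ S ∈ F, S₀ ⊆ S ∧ ∀ i, S ∈ D i := by
  obtain ⟨e⟩ : Nonempty ((#ι).ord.ToType ≃ ι) := Cardinal.eq.1 (mk_ord_toType _)
  obtain ⟨S, hSF, hS₀S, hS⟩ := exists_superset_forall_mem_of_wellFoundedLT (D := D ∘ e) hκ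
    (fun t => (mk_Iio_lt t (by simp)).trans_le ((mk_ord_toType _).trans_le hι)) hF
    (fun t => hD _) hS₀F hS₀ hS₀κ fun t => hstep _
  exact ⟨S, hSF, hS₀S, e.surjective.forall.2 hS⟩

end FiniteCharacter

section DominatingNumber

theorem exists_frequently_lt_of_mk_lt_dominatingNumber {K : Type} (hK : #K < dominatingNumber)
    (h : K → ℕ → ℕ) : ∃ g : ℕ → ℕ, ∀ k, ∃ᶠ n in atTop, h k n < g n := by
  by_contra! hcon
  have hdom : IsDominating (Set.range h) := fun f => by simpa using hcon f
  exact (csInf_le' ⟨_, hdom, rfl⟩ : dominatingNumber ≤ _).not_gt (mk_range_le.trans_lt hK)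

theorem aleph0_lt_dominatingNumber : ℵ₀ < dominatingNumber := by
  obtain ⟨D, hD, hDcard⟩ : dominatingNumber ∈ {κ | ∃ D, IsDominating D ∧ #D = κ} :=
    csInf_mem ⟨_, Set.univ, fun f => ⟨f, trivial, by simp⟩, rfl⟩
  rw [← hDcard, ← not_le, le_aleph0_iff_set_countable]
  intro hcount
  obtain ⟨d, rfl⟩ := hcount.exists_eq_range ((hD 0).imp fun _ => And.left)
  obtain ⟨_, ⟨k, rfl⟩, hk⟩ := hD fun n => (Finset.range (n + 1)).sup (d · n) + 1
  obtain ⟨n, hn, hkn⟩ := (hk.and (eventually_ge_atTop k)).exists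
  exact (Nat.lt_of_succ_le hn).not_ge
    (Finset.le_sup (f := (d · n)) (Finset.mem_range_succ_iff.2 hkn))

theorem exists_infinite_subset_subsingleton_inter_Icc {b : Set ℕ} (hb : b.Infinite)
    (g : ℕ → ℕ) : ∃ a ⊆ b, a.Infinite ∧ ∀ n, (a ∩ Set.Icc n (g n)).Subsingleton := by
  obtain ⟨e, heb, he⟩ := exists_seq_of_forall_finset_exists (· ∈ b)
    (fun x y => x < y ∧ ∀ n ≤ x, g n < y) fun s _ => by
      let bound : ℕ → ℕ := fun x => x ⊔ (Finset.range (x + 1)).sup g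
      obtain ⟨y, hyb, hy⟩ := hb.exists_gt (s.sup bound)
      refine ⟨y, hyb, fun x hx => ?_⟩
      obtain ⟨hxy, hgy⟩ := max_lt_iff.1 ((Finset.le_sup (f := bound) hx).trans_lt hy)
      exact ⟨hxy, fun n hn => (Finset.le_sup (Finset.mem_range_succ_iff.2 hn)).trans_lt hgy⟩
  have hmono : StrictMono e := fun i j hij => (he i j hij).1
  refine ⟨Set.range e, Set.range_subset_iff.2 heb, Set.infinite_range_of_injective hmono.injective,
    fun n => ?_⟩
  rintro _ ⟨⟨i, rfl⟩, hni, hi⟩ _ ⟨⟨j, rfl⟩, hnj, hj⟩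
  by_contra hne
  rcases lt_or_gt_of_ne (fun h => hne (congrArg e h) : i ≠ j) with hij | hji
  · exact ((he i j hij).2 n hni).not_ge hj
  · exact ((he j i hji).2 n hnj).not_ge hi

theorem exists_infinite_subset_disjoint_Icc {K : Type} (hK : #K < dominatingNumber)
    (h : K → ℕ → ℕ) {b : Set ℕ} (hb : b.Infinite) :
    ∃ a ⊆ b, a.Infinite ∧ ∀ k, ∃ m, Disjoint a (Set.Icc m (h k m)) := by
  obtain ⟨g, hg⟩ := exists_frequently_lt_of_mk_lt_dominatingNumber hK
    fun k n => h k n ⊔ h k (h k n + 1)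
  obtain ⟨a, hab, ha, hag⟩ := exists_infinite_subset_subsingleton_inter_Icc hb g
  refine ⟨a, hab, ha, fun k => ?_⟩
  obtain ⟨n, hn⟩ := (hg k).exists
  -- `a` cannot meet both of the disjoint intervals `[n, h n]` and `[h n + 1, h (h n + 1)]`.
  by_contra! hcon
  obtain ⟨x, hxa, hx⟩ := Set.not_disjoint_iff.1 (hcon n)
  obtain ⟨y, hya, hy⟩ := Set.not_disjoint_iff.1 (hcon (h k n + 1))
  have hxy : x = y := hag n ⟨hxa, by grind⟩ ⟨hya, by grind⟩
  grind

end DominatingNumber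

section GeneratedIdeal

variable {A A' : Set (Set ℕ)} {J : Set ℕ}

theorem isLowerSet_generatedIdeal : IsLowerSet (generatedIdeal A) := by
  rintro J J' hJ ⟨B, hBA, hB, hJB⟩
  exact ⟨B, hBA, hB, hJB.subset (Set.sdiff_subset_sdiff_left hJ)⟩

theorem generatedIdeal_mono (h : A ⊆ A') : generatedIdeal A ⊆ generatedIdeal A' := by
  rintro J ⟨B, hBA, hB, hJB⟩
  exact ⟨B, hBA.trans h, hB, hJB⟩

theorem union_mem_generatedIdeal_of_finite (hJ : J ∈ generatedIdeal A) {s : Set ℕ}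
    (hs : s.Finite) : J ∪ s ∈ generatedIdeal A := by
  obtain ⟨B, hBA, hB, hJB⟩ := hJ
  exact ⟨B, hBA, hB, by simpa only [Set.union_sdiff_distrib] using hJB.union hs.sdiff⟩

theorem diff_mem_generatedIdeal_of_mem_insert {a : Set ℕ} (hJ : J ∈ generatedIdeal (insert a A)) :
    J \ a ∈ generatedIdeal A := by
  obtain ⟨B, hBA, hB, hJB⟩ := hJ
  refine ⟨B \ {a}, by simpa [Set.sdiff_subset_iff] using hBA, hB.sdiff, hJB.subset ?_⟩
  rintro x ⟨⟨hxJ, hxa⟩, hxB⟩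
  refine ⟨hxJ, fun ⟨b, hb, hxb⟩ => hxB ⟨b, ⟨hb, ?_⟩, hxb⟩⟩
  rintro rfl
  exact hxa hxb

theorem exists_cofinal_subset_generatedIdeal (A : Set (Set ℕ)) :
    ∃ C ⊆ generatedIdeal A, #C ≤ max #A ℵ₀ ∧ ∀ J ∈ generatedIdeal A, ∃ K ∈ C, J ⊆ K := by
  classical
  let generator : Finset A × Finset ℕ → Set ℕ := fun p => (⋃ a ∈ p.1, a.1) ∪ p.2
  refine ⟨Set.range generator, ?_, ?_, ?_⟩
  · rintro _ ⟨⟨B, s⟩, rfl⟩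
    refine union_mem_generatedIdeal_of_finite ⟨Subtype.val '' (B : Set A), by simp,
      B.finite_toSet.image _, ?_⟩ s.finite_toSet
    simp [Set.sUnion_image]
  · have hfinset : #(Finset A) ≤ max #A ℵ₀ := by
      rcases finite_or_infinite A with hA | hA
      · exact (lt_aleph0_of_finite _).le.trans (le_max_right _ _)
      · exact (mk_finset_of_infinite A).trans_le (le_max_left _ _)
    calc #(Set.range generator) ≤ #(Finset A × Finset ℕ) := mk_range_le
      _ = #(Finset A) * ℵ₀ := by simp
      _ ≤ max #A ℵ₀ * ℵ₀ := mul_le_mul_left hfinset _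
      _ = max #A ℵ₀ := mul_aleph0_eq (le_max_right _ _)
  · rintro J ⟨B, hBA, hB, hJB⟩
    refine ⟨_, ⟨⟨hB.toFinset.subtype (· ∈ A), hJB.toFinset⟩, rfl⟩, fun x hx => ?_⟩
    by_cases hxB : x ∈ ⋃₀ B
    · obtain ⟨b, hb, hxb⟩ := hxB
      exact Or.inl (Set.mem_biUnion (x := ⟨b, hBA hb⟩) (by simpa using hb) hxb)
    · exact Or.inr (by simpa [hx] using hxB)

end GeneratedIdeal

section FinsetPositive

/-- `Z` is positive with respect to the ideal `I^{<ω}` on the finite subsets of `ℕ` that is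
generated by the families `{s | s ∩ J ≠ ∅}`, `J ∈ I`. -/
def FinsetPositive (I : Set (Set ℕ)) (Z : Set (Finset ℕ)) : Prop :=
  ∀ J ∈ I, ∃ s ∈ Z, Disjoint (s : Set ℕ) J

/-- The union over `n` of the finite sets of members of `X n` selected by the bound `g n`. -/
def boundedUnion (X : ℕ → Set (Finset ℕ)) (g : ℕ → ℕ) : Set (Finset ℕ) :=
  {s | ∃ n, s ∈ X n ∧ s ⊆ Finset.range (g n)}

theorem FinsetPositive.anti {I I' : Set (Set ℕ)} {Z : Set (Finset ℕ)} (hZ : FinsetPositive I Z)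
    (h : I' ⊆ I) : FinsetPositive I' Z :=
  fun J hJ => hZ J (h hJ)

variable {A : Set (Set ℕ)}

theorem exists_finsetPositive_boundedUnion (hA : #A < dominatingNumber)
    {X : ℕ → Set (Finset ℕ)} (hX : ∀ n, FinsetPositive (generatedIdeal A) (X n)) :
    ∃ g, FinsetPositive (generatedIdeal A) (boundedUnion X g) := by
  obtain ⟨C, hCA, hC, hcof⟩ := exists_cofinal_subset_generatedIdeal A
  choose s hsX hs using fun (K : C) n => hX n K (hCA K.2)
  obtain ⟨g, hg⟩ := exists_frequently_lt_of_mk_lt_dominatingNumber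
    (hC.trans_lt (max_lt hA aleph0_lt_dominatingNumber)) fun K n => (s K n).sup id
  refine ⟨g, fun J hJ => ?_⟩
  obtain ⟨K, hK, hJK⟩ := hcof J hJ
  obtain ⟨n, hn⟩ := (hg ⟨K, hK⟩).exists
  refine ⟨s ⟨K, hK⟩ n, ⟨n, hsX _ n, fun x hx => ?_⟩, (hs ⟨K, hK⟩ n).mono_right hJK⟩
  exact Finset.mem_range.2 ((Finset.le_sup (f := id) hx).trans_lt hn)

theorem exists_infinite_subset_finsetPositive_insert (hA : #A < dominatingNumber)
    {𝒵 : Set (Set (Finset ℕ))} (h𝒵 : #𝒵 < dominatingNumber)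
    (hpos : ∀ Z ∈ 𝒵, FinsetPositive (generatedIdeal A) Z) {b : Set ℕ} (hb : b.Infinite) :
    ∃ a ⊆ b, a.Infinite ∧ ∀ Z ∈ 𝒵, FinsetPositive (generatedIdeal (insert a A)) Z := by
  obtain ⟨C, hCA, hC, hcof⟩ := exists_cofinal_subset_generatedIdeal A
  choose s hsZ hs using fun (p : 𝒵 × C) m => hpos p.1 p.1.2 _
    (union_mem_generatedIdeal_of_finite (hCA p.2.2) (Set.finite_Iio m))
  have hcard : #(𝒵 × C) < dominatingNumber := by
    rw [mk_prod, lift_id, lift_id]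
    exact mul_lt_of_lt aleph0_lt_dominatingNumber.le h𝒵
      (hC.trans_lt (max_lt hA aleph0_lt_dominatingNumber))
  obtain ⟨a, hab, ha, hgap⟩ := exists_infinite_subset_disjoint_Icc hcard
    (fun p m => (s p m).sup id) hb
  refine ⟨a, hab, ha, fun Z hZ J hJ => ?_⟩
  obtain ⟨K, hK, hJK⟩ := hcof _ (diff_mem_generatedIdeal_of_mem_insert hJ)
  let p : 𝒵 × C := (⟨Z, hZ⟩, ⟨K, hK⟩)
  obtain ⟨m, hm⟩ := hgap p
  obtain ⟨hsK, hsm⟩ := Set.disjoint_union_right.1 (hs p m)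
  refine ⟨s p m, hsZ p m, Set.disjoint_left.2 fun x hxs hxJ => ?_⟩
  have hxa : x ∉ a := fun hxa => Set.disjoint_left.1 hm hxa
    ⟨not_lt.1 (Set.disjoint_left.1 hsm hxs), Finset.le_sup (f := id) hxs⟩
  exact Set.disjoint_left.1 hsK hxs (hJK ⟨hxJ, hxa⟩)

end FinsetPositive

section Menger

theorem isClosed_setOf_forall_eq_false {ι : Type*} (s : Set ι) :
    IsClosed {x : ι → Bool | ∀ i ∈ s, x i = false} := by
  simp only [Set.ofPred_forall]
  exact isClosed_biInter fun i _ => isClosed_eq (continuous_apply i) continuous_const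

theorem exists_finset_forall_eq_false_mem {ι : Type*} {O : Set (ι → Bool)} (hO : IsOpen O)
    {J : Set ι} (hJO : ∀ x : ι → Bool, (∀ i ∈ Jᶜ, x i = false) → x ∈ O) :
    ∃ s : Finset ι, Disjoint (s : Set ι) J ∧ ∀ x : ι → Bool, (∀ i ∈ s, x i = false) → x ∈ O := by
  have hcov : Oᶜ ⊆ ⋃ i ∈ Jᶜ, {x : ι → Bool | x i = true} := fun x hx => by
    have := mt (hJO x) hx
    push Not at this
    simpa using this
  obtain ⟨s, hsJ, hs, hOs⟩ := hO.isClosed_compl.isCompact.elim_finite_subcover_image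
    (fun i _ => isOpen_discrete {true} |>.preimage (continuous_apply i)) hcov
  refine ⟨hs.toFinset, by simpa using Set.disjoint_left.2 hsJ, fun x hx => ?_⟩
  by_contra hxO
  obtain ⟨i, hi, hxi⟩ := Set.mem_iUnion₂.1 (hOs hxO)
  simp_all

variable {I : Set (Set ℕ)}

/-- The finite sets `s` such that `U` has a finite subfamily covering all members of `I` that are
disjoint from `s`. -/
def finitelyCovered (U : Set (Set (charFunctionSet I))) : Set (Finset ℕ) :=
  {s | ∃ V ⊆ U, V.Finite ∧ ∀ x : charFunctionSet I, (∀ i ∈ s, x.1 i = false) → x ∈ ⋃₀ V}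

theorem mem_charFunctionSet_of_forall_compl (hI : IsLowerSet I) {J : Set ℕ} (hJ : J ∈ I)
    {x : ℕ → Bool} (hx : ∀ i ∈ Jᶜ, x i = false) : x ∈ charFunctionSet I := by
  refine hI (fun i hi => ?_) hJ
  by_contra hiJ
  exact Bool.false_ne_true ((hx i hiJ).symm.trans hi)

theorem isCompact_setOf_forall_compl_eq_false (hI : IsLowerSet I) {J : Set ℕ} (hJ : J ∈ I) :
    IsCompact {x : charFunctionSet I | ∀ i ∈ Jᶜ, x.1 i = false} := by
  rw [Subtype.isCompact_iff]
  convert (isClosed_setOf_forall_eq_false Jᶜ).isCompact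
  refine Set.Subset.antisymm ?_ fun x hx =>
    ⟨⟨x, mem_charFunctionSet_of_forall_compl hI hJ hx⟩, hx, rfl⟩
  rintro _ ⟨x, hx, rfl⟩
  exact hx

theorem finsetPositive_finitelyCovered (hI : IsLowerSet I) {U : Set (Set (charFunctionSet I))}
    (hUopen : ∀ u ∈ U, IsOpen u) (hU : ⋃₀ U = Set.univ) :
    FinsetPositive I (finitelyCovered U) := by
  intro J hJ
  obtain ⟨V, hVU, hV, hJV⟩ :=
    (isCompact_setOf_forall_compl_eq_false hI hJ).elim_finite_subcover_image hUopen
      (c := id) (by simp [← Set.sUnion_eq_biUnion, hU])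
  obtain ⟨O, hO, hOV⟩ := isOpen_induced_iff.1 (isOpen_sUnion fun u hu => hUopen u (hVU hu))
  simp only [id, ← Set.sUnion_eq_biUnion] at hJV
  obtain ⟨s, hsJ, hs⟩ := exists_finset_forall_eq_false_mem hO (J := J) fun x hx =>
    hOV.superset (hJV (show ⟨x, mem_charFunctionSet_of_forall_compl hI hJ hx⟩ ∈ _ from hx))
  exact ⟨s, ⟨V, hVU, hV, fun x hx => hOV.subset (hs x hx)⟩, hsJ⟩

theorem isMengerFamily_of_finsetPositive_boundedUnion (hI : IsLowerSet I)
    (h : ∀ X : ℕ → Set (Finset ℕ), (∀ n, FinsetPositive I (X n)) →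
      ∃ g, FinsetPositive I (boundedUnion X g)) : IsMengerFamily I := by
  intro U hU
  obtain ⟨g, hg⟩ := h (fun n => finitelyCovered (U n)) fun n =>
    finsetPositive_finitelyCovered hI (hU n).1 (hU n).2
  choose! V hVU hV hcov using fun n s (hs : s ∈ finitelyCovered (U n)) => hs
  let selected : ℕ → Set (Finset ℕ) := fun n =>
    {s | s ∈ finitelyCovered (U n) ∧ s ⊆ Finset.range (g n)}
  have hselected : ∀ n, (selected n).Finite := fun n =>
    (Finset.range (g n)).powerset.finite_toSet.subset fun s hs =>
      Finset.mem_coe.2 (Finset.mem_powerset.2 hs.2)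
  refine ⟨fun n => ⋃ s ∈ selected n, V n s, fun n => ⟨?_, ?_⟩, Set.eq_univ_of_forall fun x => ?_⟩
  · exact Set.iUnion₂_subset fun s hs => hVU n s hs.1
  · exact (hselected n).biUnion fun s hs => hV n s hs.1
  · obtain ⟨s, ⟨n, hs, hsg⟩, hsx⟩ := hg _ x.2
    obtain ⟨u, hu, hxu⟩ := hcov n s hs x fun i hi => by simpa using Set.disjoint_left.1 hsx hi
    exact Set.mem_iUnion.2 ⟨n, u, Set.mem_biUnion (show s ∈ selected n from ⟨hs, hsg⟩) hu, hxu⟩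

end Menger

section Approximation

/-- An approximation to the mad family: the left summand of `S` is an almost disjoint part of that
family, the right summand holds the sets that have to stay positive for the generated ideal. -/
structure IsApproximation (S : Set (Set ℕ ⊕ Set (Finset ℕ))) : Prop where
  infinite : ∀ a ∈ Sum.inl ⁻¹' S, a.Infinite
  pairwise : (Sum.inl ⁻¹' S).Pairwise fun a b => (a ∩ b).Finite
  positive : ∀ Z ∈ Sum.inr ⁻¹' S, FinsetPositive (generatedIdeal (Sum.inl ⁻¹' S)) Z

/-- The requirement that `S` settles the instance `X` of the combinatorial form of the Menger
property: some `X n` is not positive, or a bounded union of `X` is kept positive. -/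
def decidesSelection (X : ℕ → Set (Finset ℕ)) : Set (Set (Set ℕ ⊕ Set (Finset ℕ))) :=
  {S | (∀ n, FinsetPositive (generatedIdeal (Sum.inl ⁻¹' S)) (X n)) →
    ∃ g, boundedUnion X g ∈ Sum.inr ⁻¹' S}

/-- The requirement that `b`, if infinite, is not almost disjoint from the left summand of `S`. -/
def blocks (b : Set ℕ) : Set (Set (Set ℕ ⊕ Set (Finset ℕ))) :=
  {S | b.Infinite → ∃ c ∈ Sum.inl ⁻¹' S, (c ∩ b).Infinite}

variable {S T : Set (Set ℕ ⊕ Set (Finset ℕ))}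

theorem IsApproximation.subset (hS : IsApproximation S) (h : T ⊆ S) : IsApproximation T where
  infinite a ha := hS.infinite a (h ha)
  pairwise := hS.pairwise.mono (Set.preimage_mono h)
  positive Z hZ := (hS.positive Z (h hZ)).anti (generatedIdeal_mono (Set.preimage_mono h))

theorem isOfFiniteCharacter_isApproximation : IsOfFiniteCharacter {S | IsApproximation S} := by
  refine fun S => ⟨fun hS T hTS _ => hS.subset hTS, fun h => ⟨fun a ha => ?_, ?_, ?_⟩⟩
  · exact (h {Sum.inl a} (by simpa using ha) (Set.finite_singleton _)).infinite a rfl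
  · intro a ha b hb hab
    exact (h {Sum.inl a, Sum.inl b} (Set.pair_subset ha hb) (Set.toFinite _)).pairwise
      (by simp) (by simp) hab
  · rintro Z hZ J ⟨B, hBS, hB, hJB⟩
    have hT : insert (Sum.inr Z) (Sum.inl '' B) ⊆ S :=
      Set.insert_subset hZ (Set.image_subset_iff.2 hBS)
    exact (h _ hT ((hB.image _).insert _)).positive Z (by simp) J
      ⟨B, fun b hb => by simpa using hb, hB, hJB⟩

theorem isUpperSet_decidesSelection (X : ℕ → Set (Finset ℕ)) :
    IsUpperSet (decidesSelection X) := fun _ _ hST hS hX =>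
  (hS fun n => (hX n).anti (generatedIdeal_mono (Set.preimage_mono hST))).imp fun _ hg => hST hg

theorem isUpperSet_blocks (b : Set ℕ) : IsUpperSet (blocks b) := fun _ _ hST hS hb =>
  (hS hb).imp fun _ hc => ⟨hST hc.1, hc.2⟩

theorem preimage_inl_insert_inl {α β : Type*} (a : α) (S : Set (α ⊕ β)) :
    Sum.inl ⁻¹' insert (Sum.inl a) S = insert a (Sum.inl ⁻¹' S) := by
  ext; simp

theorem preimage_inl_insert_inr {α β : Type*} (y : β) (S : Set (α ⊕ β)) :
    Sum.inl ⁻¹' insert (Sum.inr y) S = Sum.inl ⁻¹' S := by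
  ext; simp

theorem IsApproximation.exists_insert_mem_decidesSelection (hS : IsApproximation S)
    (hScard : #S < dominatingNumber) {X : ℕ → Set (Finset ℕ)} (hX : S ∉ decidesSelection X) :
    ∃ x, IsApproximation (insert x S) ∧ insert x S ∈ decidesSelection X := by
  have hXpos : ∀ n, FinsetPositive (generatedIdeal (Sum.inl ⁻¹' S)) (X n) := by
    by_contra hneg
    exact hX fun hpos => absurd hpos hneg
  obtain ⟨g, hg⟩ := exists_finsetPositive_boundedUnion
    ((mk_preimage_of_injective _ _ Sum.inl_injective).trans_lt hScard) hXpos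
  refine ⟨Sum.inr (boundedUnion X g), ⟨?_, ?_, ?_⟩, fun _ => ⟨g, Set.mem_insert _ _⟩⟩
  · simpa only [preimage_inl_insert_inr] using hS.infinite
  · simpa only [preimage_inl_insert_inr] using hS.pairwise
  · rw [preimage_inl_insert_inr]
    rintro Z (hZ | hZ)
    · rwa [Sum.inr_injective hZ]
    · exact hS.positive Z hZ

theorem IsApproximation.exists_insert_mem_blocks (hS : IsApproximation S)
    (hScard : #S < dominatingNumber) {b : Set ℕ} (hb : S ∉ blocks b) :
    ∃ x, IsApproximation (insert x S) ∧ insert x S ∈ blocks b := by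
  obtain ⟨hbinf, hbS⟩ : b.Infinite ∧ ∀ c ∈ Sum.inl ⁻¹' S, (c ∩ b).Finite := by
    simpa [blocks] using hb
  obtain ⟨a, hab, ha, hpos⟩ := exists_infinite_subset_finsetPositive_insert
    ((mk_preimage_of_injective _ _ Sum.inl_injective).trans_lt hScard)
    ((mk_preimage_of_injective _ _ Sum.inr_injective).trans_lt hScard) hS.positive hbinf
  have haS : ∀ c ∈ Sum.inl ⁻¹' S, (c ∩ a).Finite := fun c hc =>
    (hbS c hc).subset (Set.inter_subset_inter_right c hab)
  refine ⟨Sum.inl a, ⟨?_, ?_, fun Z hZ => ?_⟩, fun _ => ⟨a, Set.mem_insert _ _, ?_⟩⟩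
  · rw [preimage_inl_insert_inl]
    exact Set.forall_mem_insert.2 ⟨ha, hS.infinite⟩
  · rw [preimage_inl_insert_inl]
    exact hS.pairwise.insert fun c hc _ => ⟨Set.inter_comm c a ▸ haS c hc, haS c hc⟩
  · rw [preimage_inl_insert_inl]
    exact hpos Z (by simpa using hZ)
  · rwa [Set.inter_eq_left.2 hab]

end Approximation

theorem isMadFamily_of_forall_infinite_inter {A : Set (Set ℕ)} (hA : IsAlmostDisjointFamily A)
    (h : ∀ b : Set ℕ, b.Infinite → ∃ c ∈ A, (c ∩ b).Infinite) : IsMadFamily A := by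
  refine ⟨hA, fun A' hA' hAA' b hb => ?_⟩
  obtain ⟨c, hc, hcb⟩ := h b (hA'.2.1 b hb)
  by_contra hbA
  exact hcb (hA'.2.2 (hAA' hc) hb fun h => hbA (h ▸ hc))

theorem exists_countable_isAlmostDisjointFamily :
    ∃ A : Set (Set ℕ), A.Countable ∧ IsAlmostDisjointFamily A := by
  let column : ℕ → Set ℕ := fun n => Set.range (Nat.pair n)
  have hdisj : ∀ m n, column m ≠ column n → Disjoint (column m) (column n) := by
    rintro m n hmn
    refine Set.disjoint_left.2 ?_
    rintro _ ⟨k, rfl⟩ ⟨l, hl⟩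
    exact hmn (congrArg column (Nat.pair_eq_pair.1 hl).1.symm)
  have hinf : ∀ n, (column n).Infinite := fun n =>
    Set.infinite_range_of_injective fun k k' h => (Nat.pair_eq_pair.1 h).2
  have hinj : Function.Injective column := fun m n hmn => by
    obtain ⟨k, hk⟩ : Nat.pair m 0 ∈ column n := hmn ▸ ⟨0, rfl⟩
    exact (Nat.pair_eq_pair.1 hk).1.symm
  refine ⟨Set.range column, Set.countable_range _, Set.infinite_range_of_injective hinj,
    Set.forall_mem_range.2 hinf, ?_⟩
  rintro _ ⟨m, rfl⟩ _ ⟨n, rfl⟩ hmn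
  simp [(hdisj m n hmn).inter_eq]

theorem IsAlmostDisjointFamily.isApproximation_image_inl {A : Set (Set ℕ)}
    (hA : IsAlmostDisjointFamily A) : IsApproximation (Sum.inl '' A) := by
  have hinl : Sum.inl ⁻¹' (Sum.inl '' A : Set (Set ℕ ⊕ Set (Finset ℕ))) = A :=
    Set.preimage_image_eq _ Sum.inl_injective
  exact ⟨hinl.symm ▸ hA.2.1, hinl.symm ▸ hA.2.2, by simp⟩

theorem proposition3p2_general (h : dominatingNumber = continuum) {A₀ : Set (Set ℕ)}
    (hA₀ : IsAlmostDisjointFamily A₀) (hA₀card : #A₀ < continuum) :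
    ∃ A ⊇ A₀, IsMadFamily A ∧ IsMengerFamily (generatedIdeal A) := by
  obtain ⟨S, hS, hA₀S, hreq⟩ := exists_superset_forall_mem aleph0_lt_continuum.le
    (ι := (ℕ → Set (Finset ℕ)) ⊕ Set ℕ) (D := Sum.elim decidesSelection blocks) (by simp)
    isOfFiniteCharacter_isApproximation
    (Sum.forall.2 ⟨isUpperSet_decidesSelection, isUpperSet_blocks⟩) hA₀.isApproximation_image_inl
    (hA₀.1.nonempty.image _) (mk_image_le.trans_lt hA₀card) (Sum.forall.2
      ⟨fun X S hS hScard hX => hS.exists_insert_mem_decidesSelection (h ▸ hScard) hX,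
        fun b S hS hScard hb => hS.exists_insert_mem_blocks (h ▸ hScard) hb⟩)
  have hA₀A : A₀ ⊆ Sum.inl ⁻¹' S := Set.image_subset_iff.1 hA₀S
  refine ⟨Sum.inl ⁻¹' S, hA₀A, ?_, ?_⟩
  · exact isMadFamily_of_forall_infinite_inter
      ⟨hA₀.1.mono hA₀A, hS.infinite, hS.pairwise⟩ fun b => hreq (Sum.inr b)
  · exact isMengerFamily_of_finsetPositive_boundedUnion isLowerSet_generatedIdeal
      fun X hX => (hreq (Sum.inl X) hX).imp fun g hg => hS.positive _ hg

theorem proposition3p2 (h : dominatingNumber = Cardinal.continuum) :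
    ∃ A : Set (Set ℕ), A.Infinite ∧ IsMadFamily A ∧ IsMengerFamily (generatedIdeal A) := by
  obtain ⟨A₀, hA₀count, hA₀⟩ := exists_countable_isAlmostDisjointFamily
  obtain ⟨A, -, hmad, hmenger⟩ := proposition3p2_general h hA₀
    (hA₀count.le_aleph0.trans_lt aleph0_lt_continuum)
  exact ⟨A, hmad.prop.1, hmad, hmenger⟩
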